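/- Let $L>0$, $\Omega=(-L,L)$, $\lambda>0$ and $f(x)=\lambda x$ on $\Omega$. For $\alpha\in C([-L,L])$ with $\alpha>0$ on $[-L,L]$ consider the weighted total variation problem $$\min_{u\in BV(\Omega)}\ \frac12\int_\Omega (f-u)^2\,dx+\int_\Omega \alpha\,d|Du| ,\qquad (1)$$ and for $w\in L^\infty(\Omega)$ with $w\ge 0$ a.e. the problem with weighted fidelity $$\min_{u\in BV(\Omega)}\ \frac12\int_\Omega w\,(f-u)^2\,dx+|Du|(\Omega). \qquad (2)$$ Let $-L<x_1\le x_2<L$ and let $u$ be (a.e. equal to) the clipped affine function $$u(x)=\lambda x_1 \text{ on } (-L,x_1),\qquad u(x)=\lambda x \text{ on } [x_1,x_2],\qquad u(x)=\lambda x_2 \text{ on } (x_2,L). $$ Then: (i) If $u$ solves (1) for some $\alpha\in C([-L,L])$ with $\alpha>0$, then $x_1=-x_2$, so that $u$ is symmetric with respect to the origin, i.e. $u(-x)=-u(x)$ for a.e. $x\in\Omega$. (ii) There exist $\alpha\in C([-L,L])$, $\alpha>0$, and $w\in L^\infty(\Omega)$, $w\ge0$, such that $u$ solves both (1) and (2)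 if and only if $x_1=-x_2$. (iii) $x_1=-x_2$ if and only if there is a constant $\alpha_0>0$ such that $u$ solves the scalar total variation problem, that is, (1) with $\alpha\equiv\alpha_0$. -/

import Mathlib

open MeasureTheory Set

namespace WeightedTV

noncomputable section

/-- The integral `∫_Ω φ dμ` of a function against a finite signed Borel measure, through the
Jordan decomposition `μ = μ⁺ - μ⁻`. -/
def signedIntegral (Ω : Set ℝ) (φ : ℝ → ℝ) (μ : SignedMeasure ℝ) : ℝ :=
  (∫ x in Ω, φ x ∂μ.toJordanDecomposition.posPart) -
    ∫ x in Ω, φ x ∂μ.toJordanDecomposition.negPart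

/-- `u ∈ BV(Ω)` and `Du = μ` on `Ω`: the function `u` is integrable on `Ω` and its distributional
derivative on `Ω` is the finite signed measure `μ`, that is `∫_Ω u φ' dx = - ∫_Ω φ dμ` for all
`φ ∈ C_c¹(Ω)`.  (On the open set `Ω` the measure `μ`, hence also `|μ|`, is determined by `u`;
the values of `μ` outside `Ω` play no role.) -/
def HasBVDeriv (Ω : Set ℝ) (u : ℝ → ℝ) (μ : SignedMeasure ℝ) : Prop :=
  IntegrableOn u Ω ∧
    ∀ φ : ℝ → ℝ, ContDiff ℝ 1 φ → HasCompactSupport φ → tsupport φ ⊆ Ω →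
      ∫ x in Ω, u x * deriv φ x = - signedIntegral Ω φ μ

/-- `½ ∫_Ω w (f - u)² dx + ∫_Ω α d|μ|`, with values in `[0, ∞]`, for nonnegative weights
`w` (of the fidelity term) and `α` (of the total variation). -/
def energy (Ω : Set ℝ) (w α f u : ℝ → ℝ) (μ : SignedMeasure ℝ) : ENNReal :=
  (∫⁻ x in Ω, ENNReal.ofReal (1 / 2 * (w x * (f x - u x) ^ 2))) +
    ∫⁻ x in Ω, ENNReal.ofReal (α x) ∂μ.totalVariation

/-- `u` minimises `½ ∫_Ω w (f - v)² dx + ∫_Ω α d|Dv|` over all `v ∈ BV(Ω)`. -/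
def IsMinimiser (Ω : Set ℝ) (w α f u : ℝ → ℝ) : Prop :=
  ∃ μ : SignedMeasure ℝ, HasBVDeriv Ω u μ ∧
    ∀ (v : ℝ → ℝ) (ν : SignedMeasure ℝ), HasBVDeriv Ω v ν →
      energy Ω w α f u μ ≤ energy Ω w α f v ν

/-- `u` solves the weighted total variation problem
`min_{u ∈ BV(Ω)} ½ ∫_Ω (f - u)² dx + ∫_Ω α d|Du|`. -/
def SolvesWeightedTV (Ω : Set ℝ) (α f u : ℝ → ℝ) : Prop :=
  IsMinimiser Ω (fun _ => 1) α f u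

/-- `u` solves the total variation problem with weighted fidelity term
`min_{u ∈ BV(Ω)} ½ ∫_Ω w (f - u)² dx + |Du|(Ω)`. -/
def SolvesWeightedFidelity (Ω : Set ℝ) (w f u : ℝ → ℝ) : Prop :=
  IsMinimiser Ω w (fun _ => 1) f u

/-- `u` solves the total variation problem with scalar parameter `α₀`,
`min_{u ∈ BV(Ω)} ½ ∫_Ω (f - u)² dx + α₀ |Du|(Ω)`. -/
def SolvesScalarTV (Ω : Set ℝ) (α₀ : ℝ) (f u : ℝ → ℝ) : Prop :=
  SolvesWeightedTV Ω (fun _ => α₀) f u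

/-- The affine function `x ↦ lam * x`, clipped to be constant to the left of `x₁` and to the
right of `x₂`. -/
def clippedAffine (lam x₁ x₂ : ℝ) (x : ℝ) : ℝ :=
  if x < x₁ then lam * x₁ else if x ≤ x₂ then lam * x else lam * x₂

/-- `α ∈ C([-L, L])` and `α > 0`. -/
def IsTVWeight (L : ℝ) (α : ℝ → ℝ) : Prop :=
  ContinuousOn α (Icc (-L) L) ∧ ∀ x ∈ Icc (-L) L, 0 < α x

/-- `w ∈ L^∞(-L, L)` and `w ≥ 0`. -/
def IsFidelityWeight (L : ℝ) (w : ℝ → ℝ) : Prop :=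
  MemLp w ⊤ (volume.restrict (Ioo (-L) L)) ∧ ∀ᵐ x ∂(volume.restrict (Ioo (-L) L)), 0 ≤ w x

end

end WeightedTV

namespace WeightedTV

/-! Necessity: adding a constant to `u` leaves `Du` unchanged, so a minimiser of (1) has `∫ (f - u)
= 0` whatever the weight `α` (`IsMinimiser.integral_sub_eq_zero`). For the clipped function this
integral is `-lam (x₁ + x₂) (L - (x₂ - x₁) / 2)`, whose last factor is positive, so `x₁ = -x₂`.
Sufficiency: for `x₂ = a = -x₁` a dual certificate shows optimality. The primitive `z` of `u - f`
with `z(-L) = 0` also vanishes at `L`, is positive in between, and attains its maximum `α₀ = lam (L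
- a)² / 2` on all of `[-a, a]`, where `Du` lives. Hence `-∫ v z' ≤ α₀ |Dv|(Ω)` for every `v`, with
equality for `u`, and convexity of the fidelity concludes (`isMinimiser_of_dual`). Dividing the
energy by `α₀` gives (2) with `w = 1 / α₀`. -/

/-! ### A `C¹` truncation near zero -/

theorem hasDerivAt_max_zero_sq (x : ℝ) :
    HasDerivAt (fun y : ℝ => max y 0 ^ 2) (2 * max x 0) x := by
  rcases lt_trichotomy x 0 with h | rfl | h
  · rw [max_eq_right h.le, mul_zero]
    refine (hasDerivAt_const x (0 : ℝ)).congr_of_eventuallyEq ?_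
    filter_upwards [Iio_mem_nhds h] with y hy
    simp [max_eq_right (mem_Iio.1 hy).le]
  -- At the kink the function is at most `y²`, so its derivative is `0`.
  · have hO : (fun y : ℝ => max y 0 ^ 2) =O[nhds 0] fun y => ‖y - 0‖ ^ 2 := by
      refine Asymptotics.IsBigO.of_bound 1 (Filter.Eventually.of_forall fun y => ?_)
      have h1 : |max y 0| ≤ |y| := by
        rcases le_total y 0 with hy | hy <;> simp [hy]
      simpa using pow_le_pow_left₀ (abs_nonneg _) h1 2
    simpa using (hO.hasFDerivAt (by norm_num)).hasDerivAt
  · rw [max_eq_left h.le]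
    have h2 : HasDerivAt (fun y : ℝ => y ^ 2) (2 * x) x := by
      simpa using hasDerivAt_pow 2 x
    refine h2.congr_of_eventuallyEq ?_
    filter_upwards [Ioi_mem_nhds h] with y hy
    simp [max_eq_left (mem_Ioi.1 hy).le]

/-- A `C¹` function that vanishes on `(-∞, ε]` and equals `s - 3ε/2` on `[2ε, ∞)`. -/
noncomputable def softThreshold (ε s : ℝ) : ℝ :=
  (max (s - ε) 0 ^ 2 - max (s - 2 * ε) 0 ^ 2) / (2 * ε)

/-- The derivative of `softThreshold ε`. -/
noncomputable def softStep (ε s : ℝ) : ℝ :=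
  (max (s - ε) 0 - max (s - 2 * ε) 0) / ε

theorem hasDerivAt_softThreshold {ε : ℝ} (hε : 0 < ε) (s : ℝ) :
    HasDerivAt (softThreshold ε) (softStep ε s) s := by
  have h (c : ℝ) : HasDerivAt (fun y : ℝ => max (y - c) 0 ^ 2) (2 * max (s - c) 0) s :=
    (hasDerivAt_max_zero_sq (s - c)).comp_sub_const s c
  refine (((h ε).sub (h (2 * ε))).div_const (2 * ε)).congr_deriv ?_
  unfold softStep
  field_simp

theorem continuous_softStep (ε : ℝ) : Continuous (softStep ε) := by
  unfold softStep
  fun_prop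

theorem softStep_mem_Icc {ε : ℝ} (hε : 0 < ε) (s : ℝ) : softStep ε s ∈ Icc 0 1 := by
  unfold softStep
  constructor
  · refine div_nonneg ?_ hε.le
    rw [sub_nonneg]
    exact max_le_max (by linarith) le_rfl
  · rw [div_le_one hε]
    have : max (s - ε) 0 ≤ max (s - 2 * ε) 0 + ε :=
      max_le (by linarith [le_max_left (s - 2 * ε) 0]) (by linarith [le_max_right (s - 2 * ε) 0])
    linarith

theorem softStep_eq_one {ε s : ℝ} (hε : 0 < ε) (hs : 2 * ε ≤ s) : softStep ε s = 1 := by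
  unfold softStep
  rw [max_eq_left (by linarith), max_eq_left (by linarith)]
  field_simp
  ring

theorem softThreshold_eq_zero {ε s : ℝ} (hε : 0 < ε) (hs : s ≤ ε) : softThreshold ε s = 0 := by
  unfold softThreshold
  rw [max_eq_right (by linarith), max_eq_right (by linarith)]
  simp

theorem softThreshold_nonneg {ε : ℝ} (hε : 0 < ε) (s : ℝ) : 0 ≤ softThreshold ε s := by
  unfold softThreshold
  refine div_nonneg ?_ (by linarith)
  rw [sub_nonneg]
  exact pow_le_pow_left₀ (le_max_right _ _) (max_le_max (by linarith) le_rfl) 2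

/-- Truncating a field thus preserves its upper bound `M`, the constant in front of the total
variation. -/
theorem softThreshold_le {ε s : ℝ} (hε : 0 < ε) (hs : 0 ≤ s) : softThreshold ε s ≤ s := by
  unfold softThreshold
  rw [div_le_iff₀ (by linarith)]
  rcases le_total (s - ε) 0 with h1 | h1 <;> rcases le_total (s - 2 * ε) 0 with h2 | h2 <;>
    simp only [max_eq_left, max_eq_right, h1, h2] <;> nlinarith

/-! ### Integration by parts up to the boundary -/

theorem setIntegral_le_mul_measureReal {m : Measure ℝ} [IsFiniteMeasure m] {Ω : Set ℝ}
    {φ : ℝ → ℝ} {M : ℝ} (hφ : ∀ x, |φ x| ≤ M) :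
    |∫ x in Ω, φ x ∂m| ≤ M * m.real Ω :=
  norm_setIntegral_le_of_norm_le_const (f := φ) (measure_lt_top m Ω) fun x _ => hφ x

theorem abs_signedIntegral_le {Ω : Set ℝ} {φ : ℝ → ℝ} {ν : SignedMeasure ℝ} {M : ℝ}
    (hφ : ∀ x, |φ x| ≤ M) :
    |signedIntegral Ω φ ν| ≤ M * ν.totalVariation.real Ω := by
  unfold signedIntegral SignedMeasure.totalVariation
  rw [measureReal_add_apply, mul_add]
  exact (abs_sub _ _).trans
    (add_le_add (setIntegral_le_mul_measureReal hφ) (setIntegral_le_mul_measureReal hφ))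

/-- Integration by parts against a `C¹` field that is positive in the interval and vanishes at its
end points: such a field need not have compact support in the open interval. -/
theorem HasBVDeriv.neg_mul_totalVariation_le {a b : ℝ} {v z z' : ℝ → ℝ} {ν : SignedMeasure ℝ}
    {M : ℝ} (hv : HasBVDeriv (Ioo a b) v ν) (hz : ∀ x, HasDerivAt z (z' x) x)
    (hz' : Continuous z') (hpos : ∀ x ∈ Ioo a b, 0 < z x) (hneg : ∀ x ∉ Ioo a b, z x ≤ 0)
    (hzM : ∀ x, z x ≤ M) (hM : 0 ≤ M) :
    -(M * ν.totalVariation.real (Ioo a b)) ≤ ∫ x in Ioo a b, v x * z' x := by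
  have hzc : Continuous z := continuous_iff_continuousAt.2 fun x => (hz x).continuousAt
  have hε (n : ℕ) : (0 : ℝ) < 1 / (n + 1) := by positivity
  obtain ⟨C, hC⟩ : ∃ C, ∀ x ∈ Icc a b, ‖z' x‖ ≤ C :=
    isCompact_Icc.exists_bound_of_continuousOn hz'.continuousOn
  have hder (n : ℕ) (x : ℝ) : HasDerivAt (fun y => softThreshold (1 / (n + 1)) (z y))
      (softStep (1 / (n + 1)) (z x) * z' x) x :=
    (hasDerivAt_softThreshold (hε n) (z x)).comp x (hz x)
  have hderiv (n : ℕ) : deriv (fun y => softThreshold (1 / (n + 1)) (z y)) =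
      fun x => softStep (1 / (n + 1)) (z x) * z' x := funext fun x => (hder n x).deriv
  -- The truncated field is supported in `{z ≥ ε}`, a closed subset of the open interval because `z
  -- ≤ 0` outside; it is therefore an admissible test function.
  have hstep (n : ℕ) : -(M * ν.totalVariation.real (Ioo a b)) ≤
      ∫ x in Ioo a b, v x * (softStep (1 / (n + 1)) (z x) * z' x) := by
    have hcd : ContDiff ℝ 1 (fun y => softThreshold (1 / (n + 1)) (z y)) := by
      rw [contDiff_one_iff_deriv]
      refine ⟨fun x => (hder n x).differentiableAt, ?_⟩
      rw [hderiv n]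
      exact ((continuous_softStep _).comp hzc).mul hz'
    have hclosed : IsClosed {x | 1 / ((n : ℝ) + 1) ≤ z x} := isClosed_le continuous_const hzc
    have hsub : tsupport (fun y => softThreshold (1 / (n + 1)) (z y)) ⊆
        {x | 1 / ((n : ℝ) + 1) ≤ z x} := by
      refine closure_minimal (fun x hx => ?_) hclosed
      by_contra hlt
      exact hx (softThreshold_eq_zero (hε n) (not_le.1 hlt).le)
    have hΩ : {x | 1 / ((n : ℝ) + 1) ≤ z x} ⊆ Ioo a b := fun x hx => by
      by_contra hx'
      exact absurd ((hε n).trans_le hx) (hneg x hx').not_gt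
    have hcs : HasCompactSupport (fun y => softThreshold (1 / (n + 1)) (z y)) :=
      isCompact_Icc.of_isClosed_subset (isClosed_tsupport _)
        ((hsub.trans hΩ).trans Ioo_subset_Icc_self)
    have h := hv.2 _ hcd hcs (hsub.trans hΩ)
    rw [hderiv n] at h
    rw [h, neg_le_neg_iff]
    refine (le_abs_self _).trans (abs_signedIntegral_le fun x => ?_)
    rw [abs_of_nonneg (softThreshold_nonneg (hε n) _)]
    rcases le_total (z x) 0 with h0 | h0
    · rw [softThreshold_eq_zero (hε n) (h0.trans (hε n).le)]
      exact hM
    · exact (softThreshold_le (hε n) h0).trans (hzM x)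
  refine ge_of_tendsto' (tendsto_integral_of_dominated_convergence
    (fun x => ‖v x‖ * C) (fun n => ?_) (hv.1.norm.mul_const C) (fun n => ?_) ?_) hstep
  · exact hv.1.aestronglyMeasurable.mul
      (((continuous_softStep _).comp hzc).mul hz').aestronglyMeasurable
  · refine (ae_restrict_iff' measurableSet_Ioo).2 (Filter.Eventually.of_forall fun x hx => ?_)
    rw [norm_mul, norm_mul]
    have h1 := softStep_mem_Icc (hε n) (z x)
    have h2 := hC x (Ioo_subset_Icc_self hx)
    refine mul_le_mul_of_nonneg_left ?_ (norm_nonneg _)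
    rw [Real.norm_of_nonneg h1.1]
    exact (mul_le_of_le_one_left (norm_nonneg _) h1.2).trans h2
  · refine (ae_restrict_iff' measurableSet_Ioo).2 (Filter.Eventually.of_forall fun x hx => ?_)
    -- Half of `z x`, because `softStep ε` equals `1` only from `2ε` on.
    obtain ⟨N, hN⟩ := exists_nat_one_div_lt (half_pos (hpos x hx))
    refine tendsto_const_nhds.congr' ?_
    filter_upwards [Filter.eventually_ge_atTop N] with n hn
    have : 1 / ((n : ℝ) + 1) ≤ 1 / (N + 1) := by gcongr
    rw [softStep_eq_one (hε n) (by linarith), one_mul]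

/-! ### Invariances of the derivative and of the energy -/

theorem setIntegral_Ioo_eq {a b : ℝ} (hab : a ≤ b) (φ : ℝ → ℝ) :
    ∫ x in Ioo a b, φ x = ∫ x in a..b, φ x := by
  rw [intervalIntegral.integral_of_le hab, integral_Ioc_eq_integral_Ioo]

theorem eq_zero_of_tsupport_subset {Ω : Set ℝ} {φ : ℝ → ℝ} (h : tsupport φ ⊆ Ω) {x : ℝ}
    (hx : x ∉ Ω) : φ x = 0 :=
  image_eq_zero_of_notMem_tsupport fun hx' => hx (h hx')

theorem setIntegral_deriv_eq_zero {a b : ℝ} (hab : a ≤ b) {φ : ℝ → ℝ} (hφ : ContDiff ℝ 1 φ)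
    (h : tsupport φ ⊆ Ioo a b) : ∫ x in Ioo a b, deriv φ x = 0 := by
  rw [setIntegral_Ioo_eq hab, intervalIntegral.integral_deriv_eq_sub
    (fun x _ => hφ.differentiable one_ne_zero x)
    (hφ.continuous_deriv_one.intervalIntegrable _ _)]
  simp [eq_zero_of_tsupport_subset h]

theorem HasBVDeriv.add_const {a b : ℝ} (hab : a ≤ b) {u : ℝ → ℝ} {μ : SignedMeasure ℝ}
    (hu : HasBVDeriv (Ioo a b) u μ) (t : ℝ) :
    HasBVDeriv (Ioo a b) (fun x => u x + t) μ := by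
  refine ⟨hu.1.add (integrableOn_const (by simp)), fun φ hφ hc hs => ?_⟩
  have hb : ∃ C, ∀ x, ‖deriv φ x‖ ≤ C :=
    hc.deriv.exists_bound_of_continuous hφ.continuous_deriv_one
  obtain ⟨C, hC⟩ := hb
  have hi : IntegrableOn (fun x => u x * deriv φ x) (Ioo a b) :=
    Integrable.mul_bdd (c := C) hu.1 hφ.continuous_deriv_one.aestronglyMeasurable
      (Filter.Eventually.of_forall hC)
  have hi' : IntegrableOn (fun x => t * deriv φ x) (Ioo a b) :=
    ((hφ.continuous_deriv_one.integrable_of_hasCompactSupport hc.deriv).const_mul t).integrableOn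
  simp only [add_mul]
  rw [integral_add hi hi', hu.2 φ hφ hc hs, integral_const_mul,
    setIntegral_deriv_eq_zero hab hφ hs, mul_zero, add_zero]

theorem HasBVDeriv.congr_ae {Ω : Set ℝ} {u v : ℝ → ℝ} {μ : SignedMeasure ℝ}
    (h : u =ᵐ[volume.restrict Ω] v) (hu : HasBVDeriv Ω u μ) : HasBVDeriv Ω v μ := by
  refine ⟨hu.1.congr h, fun φ hφ hc hs => ?_⟩
  rw [← hu.2 φ hφ hc hs]
  refine integral_congr_ae ?_
  filter_upwards [h] with x hx
  rw [hx]

theorem energy_congr_ae {Ω : Set ℝ} {w α f u v : ℝ → ℝ} {μ : SignedMeasure ℝ}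
    (h : u =ᵐ[volume.restrict Ω] v) : energy Ω w α f u μ = energy Ω w α f v μ := by
  unfold energy
  congr 1
  refine lintegral_congr_ae ?_
  filter_upwards [h] with x hx
  rw [hx]

theorem IsMinimiser.congr_ae {Ω : Set ℝ} {w α f u v : ℝ → ℝ}
    (h : u =ᵐ[volume.restrict Ω] v) (hu : IsMinimiser Ω w α f u) : IsMinimiser Ω w α f v := by
  obtain ⟨μ, h1, h2⟩ := hu
  exact ⟨μ, h1.congr_ae h, fun y ν hy => energy_congr_ae h ▸ h2 y ν hy⟩

theorem energy_const_mul {Ω : Set ℝ} {w α f u : ℝ → ℝ} {μ : SignedMeasure ℝ} {c : ℝ}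
    (hc : 0 ≤ c) : energy Ω (fun x => c * w x) (fun x => c * α x) f u μ =
      ENNReal.ofReal c * energy Ω w α f u μ := by
  unfold energy
  rw [mul_add, ← lintegral_const_mul' _ _ ENNReal.ofReal_ne_top,
    ← lintegral_const_mul' _ _ ENNReal.ofReal_ne_top]
  simp only [← ENNReal.ofReal_mul hc]
  congr! 4
  ring

theorem IsMinimiser.const_mul {Ω : Set ℝ} {w α f u : ℝ → ℝ} {c : ℝ} (hc : 0 ≤ c)
    (hu : IsMinimiser Ω w α f u) :
    IsMinimiser Ω (fun x => c * w x) (fun x => c * α x) f u := by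
  obtain ⟨μ, h1, h2⟩ := hu
  refine ⟨μ, h1, fun v ν hv => ?_⟩
  rw [energy_const_mul hc, energy_const_mul hc]
  exact mul_le_mul_right (h2 v ν hv) _

/-! ### Sufficiency of a dual certificate -/

theorem energy_eq_ofReal {Ω : Set ℝ} {f v : ℝ → ℝ} {ν : SignedMeasure ℝ} {M : ℝ} (hM : 0 ≤ M)
    (hi : IntegrableOn (fun x => (f x - v x) ^ 2) Ω) :
    energy Ω (fun _ => 1) (fun _ => M) f v ν =
      ENNReal.ofReal (1 / 2 * (∫ x in Ω, (f x - v x) ^ 2) + M * ν.totalVariation.real Ω) := by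
  unfold energy
  have h0 : 0 ≤ ∫ x in Ω, (f x - v x) ^ 2 := integral_nonneg fun x => sq_nonneg _
  rw [ENNReal.ofReal_add (by positivity) (by positivity), ← integral_const_mul,
    ofReal_integral_eq_lintegral_ofReal (hi.const_mul _)
      (Filter.Eventually.of_forall fun x => by positivity),
    setLIntegral_const, ENNReal.ofReal_mul hM, ofReal_measureReal]
  simp only [one_mul]

/-- If `f - v` is not square integrable on `Ω`, then the energy of `v` is infinite. -/
theorem integrableOn_sq_of_energy_ne_top {Ω : Set ℝ} {α f v : ℝ → ℝ} {ν : SignedMeasure ℝ}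
    (hm : AEStronglyMeasurable (fun x => f x - v x) (volume.restrict Ω))
    (h : energy Ω (fun _ => 1) α f v ν ≠ ⊤) : IntegrableOn (fun x => (f x - v x) ^ 2) Ω := by
  have h1 : (∫⁻ x in Ω, ENNReal.ofReal (1 / 2 * (1 * (f x - v x) ^ 2))) ≠ ⊤ := fun ht =>
    h (by unfold energy; rw [ht, top_add])
  have hm2 : AEStronglyMeasurable (fun x => 1 / 2 * (1 * (f x - v x) ^ 2)) (volume.restrict Ω) :=
    ((hm.pow 2).const_mul 1).const_mul (1 / 2)
  have h2 : IntegrableOn (fun x => 1 / 2 * (1 * (f x - v x) ^ 2)) Ω :=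
    (lintegral_ofReal_ne_top_iff_integrable hm2
      (Filter.Eventually.of_forall fun x => by positivity)).1 h1
  refine (h2.const_mul 2).congr (Filter.Eventually.of_forall fun x => ?_)
  ring

/-- Sufficiency of the dual certificate `z` for the scalar total variation problem: `z' = u - f`,
`0 < z ≤ M` inside the interval, and `∫ M d|Du| ≤ -∫ u z'`. -/
theorem isMinimiser_of_dual {a b M : ℝ} {f u z : ℝ → ℝ} {μ : SignedMeasure ℝ}
    (hf : Continuous f) (hu : Continuous u) (hμ : HasBVDeriv (Ioo a b) u μ)
    (hz : ∀ x, HasDerivAt z (u x - f x) x) (hpos : ∀ x ∈ Ioo a b, 0 < z x)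
    (hneg : ∀ x ∉ Ioo a b, z x ≤ 0) (hzM : ∀ x, z x ≤ M) (hM : 0 ≤ M)
    (hext : M * μ.totalVariation.real (Ioo a b) ≤ -∫ x in Ioo a b, u x * (u x - f x)) :
    IsMinimiser (Ioo a b) (fun _ => 1) (fun _ => M) f u := by
  refine ⟨μ, hμ, fun v ν hv => ?_⟩
  -- A competitor is only assumed integrable; finite energy makes `f - v` square integrable, so the
  -- comparison can be made in `ℝ`.
  by_cases htop : energy (Ioo a b) (fun _ => 1) (fun _ => M) f v ν = ⊤
  · rw [htop]
    exact le_top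
  have hcont {g : ℝ → ℝ} (hg : Continuous g) : IntegrableOn g (Ioo a b) :=
    (hg.continuousOn.integrableOn_compact isCompact_Icc).mono_set Ioo_subset_Icc_self
  have hvi : IntegrableOn (fun x => (f x - v x) ^ 2) (Ioo a b) :=
    integrableOn_sq_of_energy_ne_top
      (hf.aestronglyMeasurable.sub hv.1.aestronglyMeasurable) htop
  have hui : IntegrableOn (fun x => (f x - u x) ^ 2) (Ioo a b) := hcont (by fun_prop)
  rw [energy_eq_ofReal hM hvi, energy_eq_ofReal hM hui]
  refine ENNReal.ofReal_le_ofReal ?_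
  have hkey := hv.neg_mul_totalVariation_le hz (hu.sub hf) hpos hneg hzM hM
  obtain ⟨C, hC⟩ : ∃ C, ∀ x ∈ Icc a b, ‖u x - f x‖ ≤ C :=
    isCompact_Icc.exists_bound_of_continuousOn (hu.sub hf).continuousOn
  have hvz : IntegrableOn (fun x => v x * (u x - f x)) (Ioo a b) :=
    Integrable.mul_bdd (c := C) hv.1 (hu.sub hf).aestronglyMeasurable
      ((ae_restrict_iff' measurableSet_Ioo).2
        (Filter.Eventually.of_forall fun x hx => hC x (Ioo_subset_Icc_self hx)))
  have huz : IntegrableOn (fun x => u x * (u x - f x)) (Ioo a b) := hcont (by fun_prop)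
  -- Convexity of the square: the two integrands differ by `(v - u)²`.
  have hmono : ∫ x in Ioo a b, ((f x - u x) ^ 2 + 2 * (v x * (u x - f x) - u x * (u x - f x))) ≤
      ∫ x in Ioo a b, (f x - v x) ^ 2 :=
    integral_mono (hui.add ((hvz.sub huz).const_mul 2)) hvi fun x => by
      nlinarith [sq_nonneg (v x - u x)]
  have hadd := integral_add hui ((hvz.sub huz).const_mul 2)
  simp only [Pi.sub_apply] at hadd
  rw [hadd, integral_const_mul, integral_sub hvz huz] at hmono
  linarith

/-! ### Necessity: variation by constants -/

/-- Optimality with respect to the addition of constants. -/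
theorem IsMinimiser.integral_sub_eq_zero {a b : ℝ} (hab : a < b) {α f u : ℝ → ℝ}
    (hα : ContinuousOn α (Icc a b)) (hf : Continuous f) (hu : Continuous u)
    (h : IsMinimiser (Ioo a b) (fun _ => 1) α f u) : ∫ x in Ioo a b, (f x - u x) = 0 := by
  obtain ⟨μ, hμ, hmin⟩ := h
  have hcont {g : ℝ → ℝ} (hg : Continuous g) : IntegrableOn g (Ioo a b) :=
    (hg.continuousOn.integrableOn_compact isCompact_Icc).mono_set Ioo_subset_Icc_self
  -- Finiteness allows this term to be cancelled in `ENNReal`.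
  have htv : ∫⁻ x in Ioo a b, ENNReal.ofReal (α x) ∂μ.totalVariation ≠ ⊤ := by
    obtain ⟨C, hC⟩ := isCompact_Icc.exists_bound_of_continuousOn hα
    refine ((setLIntegral_mono measurable_const fun x hx => ENNReal.ofReal_le_ofReal
      ((le_abs_self _).trans (hC x (Ioo_subset_Icc_self hx)))).trans_lt ?_).ne
    rw [setLIntegral_const]
    exact ENNReal.mul_lt_top ENNReal.ofReal_lt_top (measure_lt_top _ _)
  have hreal (t : ℝ) : ∫ x in Ioo a b, 1 / 2 * (1 * (f x - u x) ^ 2) ≤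
      ∫ x in Ioo a b, 1 / 2 * (1 * (f x - (u x + t)) ^ 2) := by
    have h1 := ENNReal.le_of_add_le_add_right htv (hmin _ μ (hμ.add_const hab.le t))
    rw [← ofReal_integral_eq_lintegral_ofReal (hcont (by fun_prop))
        (Filter.Eventually.of_forall fun x => by positivity),
      ← ofReal_integral_eq_lintegral_ofReal (hcont (by fun_prop))
        (Filter.Eventually.of_forall fun x => by positivity)] at h1
    exact (ENNReal.ofReal_le_ofReal_iff (integral_nonneg fun x => by positivity)).1 h1
  set I := ∫ x in Ioo a b, (f x - u x) with hI
  have hexp (t : ℝ) : ∫ x in Ioo a b, 1 / 2 * (1 * (f x - (u x + t)) ^ 2) =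
      (∫ x in Ioo a b, 1 / 2 * (1 * (f x - u x) ^ 2)) - t * I + (b - a) * (t ^ 2 / 2) := by
    have e : (fun x => 1 / 2 * (1 * (f x - (u x + t)) ^ 2)) =
        fun x => 1 / 2 * (1 * (f x - u x) ^ 2) - t * (f x - u x) + t ^ 2 / 2 := by
      funext x
      ring
    rw [e, integral_add (hcont (by fun_prop)) (hcont (by fun_prop)),
      integral_sub (hcont (by fun_prop)) (hcont (by fun_prop)), integral_const_mul t,
      setIntegral_const, Real.volume_real_Ioo_of_le hab.le, smul_eq_mul]
  have hba : 0 < b - a := sub_pos.2 hab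
  -- The minimiser in `t` of the quadratic `hexp`; it lowers the energy by `I² / (2 (b - a))`.
  have h2 := hreal (I / (b - a))
  rw [hexp] at h2
  have h3 : (b - a) * ((I / (b - a)) ^ 2 / 2) = I ^ 2 / (b - a) / 2 := by
    field_simp
  have h4 : I / (b - a) * I = I ^ 2 / (b - a) := by ring
  have h5 : I ^ 2 / (b - a) ≤ 0 := by linarith
  have h6 : I ^ 2 ≤ 0 := by
    by_contra hlt
    exact absurd h5 (div_pos (not_le.1 hlt) hba).not_ge
  exact pow_eq_zero_iff two_ne_zero |>.1 (le_antisymm h6 (sq_nonneg _))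

/-! ### The clipped affine function and its derivative -/

theorem clippedAffine_eq_max_min {lam x₁ x₂ : ℝ} (h : x₁ ≤ x₂) (x : ℝ) :
    clippedAffine lam x₁ x₂ x = lam * max x₁ (min x x₂) := by
  unfold clippedAffine
  split_ifs with h1 h2
  · rw [min_eq_left (by linarith), max_eq_left h1.le]
  · rw [min_eq_left h2, max_eq_right (not_lt.1 h1)]
  · rw [min_eq_right (not_le.1 h2).le, max_eq_right h]

theorem continuous_clippedAffine {lam x₁ x₂ : ℝ} (h : x₁ ≤ x₂) :
    Continuous (clippedAffine lam x₁ x₂) := by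
  rw [funext (clippedAffine_eq_max_min h)]
  fun_prop

theorem integral_clippedAffine_mul {L lam x₁ x₂ : ℝ} (hx₁ : -L ≤ x₁) (hx₁₂ : x₁ ≤ x₂)
    (hx₂ : x₂ ≤ L) {g : ℝ → ℝ} (hg : Continuous g) :
    ∫ x in Ioo (-L) L, clippedAffine lam x₁ x₂ x * g x =
      (lam * x₁ * ∫ x in (-L)..x₁, g x) + (lam * ∫ x in x₁..x₂, x * g x) +
        lam * x₂ * ∫ x in x₂..L, g x := by
  have hc : Continuous fun x => clippedAffine lam x₁ x₂ x * g x :=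
    (continuous_clippedAffine hx₁₂).mul hg
  have hi (a b : ℝ) := hc.intervalIntegrable (μ := volume) a b
  rw [setIntegral_Ioo_eq (by linarith), ← intervalIntegral.integral_add_adjacent_intervals
    ((hi (-L) x₁).trans (hi x₁ x₂)) (hi x₂ L),
    ← intervalIntegral.integral_add_adjacent_intervals (hi (-L) x₁) (hi x₁ x₂),
    ← intervalIntegral.integral_const_mul, ← intervalIntegral.integral_const_mul,
    ← intervalIntegral.integral_const_mul]
  congr 1
  · congr 1
    · refine intervalIntegral.integral_congr fun x hx => ?_
      rw [uIcc_of_le hx₁] at hx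
      simp only [clippedAffine_eq_max_min hx₁₂]
      rw [min_eq_left (hx.2.trans hx₁₂), max_eq_left hx.2]
    · refine intervalIntegral.integral_congr fun x hx => ?_
      rw [uIcc_of_le hx₁₂] at hx
      simp only [clippedAffine_eq_max_min hx₁₂]
      rw [min_eq_left hx.2, max_eq_right hx.1, mul_assoc]
  · refine intervalIntegral.integral_congr fun x hx => ?_
    rw [uIcc_of_le hx₂] at hx
    simp only [clippedAffine_eq_max_min hx₁₂]
    rw [min_eq_right hx.1, max_eq_right hx₁₂]

/-- The signed measure `lam • (Lebesgue measure on [x₁, x₂])`, as a Jordan decomposition. -/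
noncomputable def clippedAffineJordan (lam x₁ x₂ : ℝ) : JordanDecomposition ℝ where
  posPart := ENNReal.ofReal lam • volume.restrict (Icc x₁ x₂)
  negPart := 0
  posPart_finite := Measure.smul_finite _ ENNReal.ofReal_ne_top
  mutuallySingular := Measure.MutuallySingular.zero_right

/-- Integrating piece by piece, the boundary terms at `x₁` and `x₂` cancel by continuity, and those
at `±L` vanish with `φ`. -/
theorem hasBVDeriv_clippedAffine {L lam x₁ x₂ : ℝ} (hlam : 0 ≤ lam) (hx₁ : -L < x₁)
    (hx₁₂ : x₁ ≤ x₂) (hx₂ : x₂ < L) :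
    HasBVDeriv (Ioo (-L) L) (clippedAffine lam x₁ x₂)
      (clippedAffineJordan lam x₁ x₂).toSignedMeasure := by
  refine ⟨((continuous_clippedAffine hx₁₂).continuousOn.integrableOn_compact isCompact_Icc).mono_set
    Ioo_subset_Icc_self, fun φ hφ hc hs => ?_⟩
  have hd (x : ℝ) : HasDerivAt φ (deriv φ x) x :=
    (hφ.differentiable one_ne_zero x).hasDerivAt
  have hdi (a b : ℝ) := hφ.continuous_deriv_one.intervalIntegrable (μ := volume) a b
  rw [integral_clippedAffine_mul hx₁.le hx₁₂ hx₂.le hφ.continuous_deriv_one,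
    intervalIntegral.integral_eq_sub_of_hasDerivAt (fun x _ => hd x) (hdi _ _),
    intervalIntegral.integral_eq_sub_of_hasDerivAt (fun x _ => hd x) (hdi _ _),
    intervalIntegral.integral_mul_deriv_eq_deriv_mul (fun x _ => hasDerivAt_id' x)
      (fun x _ => hd x) intervalIntegrable_const (hdi _ _),
    eq_zero_of_tsupport_subset hs (x := -L) (by simp),
    eq_zero_of_tsupport_subset hs (x := L) (by simp)]
  unfold signedIntegral
  rw [JordanDecomposition.toJordanDecomposition_toSignedMeasure]
  simp only [clippedAffineJordan, Measure.restrict_zero, integral_zero_measure, sub_zero,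
    Measure.restrict_smul, integral_smul_measure, one_mul, ENNReal.toReal_ofReal hlam, smul_eq_mul]
  rw [Measure.restrict_restrict measurableSet_Ioo,
    inter_eq_right.2 (Icc_subset_Ioo hx₁ hx₂), integral_Icc_eq_integral_Ioc,
    ← intervalIntegral.integral_of_le hx₁₂]
  ring

theorem totalVariation_clippedAffine {L lam x₁ x₂ : ℝ} (hlam : 0 ≤ lam) (hx₁ : -L < x₁)
    (hx₁₂ : x₁ ≤ x₂) (hx₂ : x₂ < L) :
    (clippedAffineJordan lam x₁ x₂).toSignedMeasure.totalVariation.real (Ioo (-L) L) =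
      lam * (x₂ - x₁) := by
  unfold SignedMeasure.totalVariation
  rw [JordanDecomposition.toJordanDecomposition_toSignedMeasure]
  simp only [clippedAffineJordan, add_zero, measureReal_ennreal_smul_apply,
    ENNReal.toReal_ofReal hlam]
  rw [measureReal_restrict_apply measurableSet_Ioo, inter_eq_right.2 (Icc_subset_Ioo hx₁ hx₂),
    Real.volume_real_Icc_of_le hx₁₂]

/-! ### The symmetric case and its certificate -/

theorem clippedAffine_neg_neg {lam a : ℝ} (ha : 0 ≤ a) (x : ℝ) :
    clippedAffine lam (-a) a (-x) = -clippedAffine lam (-a) a x := by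
  rw [clippedAffine_eq_max_min (by linarith), clippedAffine_eq_max_min (by linarith),
    ← mul_neg, ← min_neg_neg, neg_neg, ← max_neg_neg, min_comm a, max_min_distrib_left,
    max_eq_right (by linarith : -a ≤ a), max_comm]

/-- The dual certificate of the symmetric clipped affine function. -/
noncomputable def dualField (L lam a x : ℝ) : ℝ :=
  lam / 2 * ((L - a) ^ 2 - max (-a - x) 0 ^ 2 - max (x - a) 0 ^ 2)

theorem hasDerivAt_dualField {lam a : ℝ} (L : ℝ) (ha : 0 ≤ a) (x : ℝ) :
    HasDerivAt (dualField L lam a) (clippedAffine lam (-a) a x - lam * x) x := by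
  have h1 : HasDerivAt (fun y : ℝ => max (-a - y) 0 ^ 2) (-(2 * max (-a - x) 0)) x :=
    (hasDerivAt_max_zero_sq (-a - x)).comp_const_sub (-a) x
  have h2 : HasDerivAt (fun y : ℝ => max (y - a) 0 ^ 2) (2 * max (x - a) 0) x :=
    (hasDerivAt_max_zero_sq (x - a)).comp_sub_const x a
  refine ((((hasDerivAt_const x ((L - a) ^ 2)).sub h1).sub h2).const_mul
    (lam / 2)).congr_deriv ?_
  -- Clipping corrects `x` by its excess beyond either threshold.
  have h3 : max (-a) (min x a) = x + max (-a - x) 0 - max (x - a) 0 := by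
    rcases le_total x a with h | h <;> rcases le_total (-a) x with h' | h'
    · rw [min_eq_left h, max_eq_right h', max_eq_right (by linarith), max_eq_right (by linarith)]
      ring
    · rw [min_eq_left h, max_eq_left h', max_eq_left (by linarith), max_eq_right (by linarith)]
      ring
    · rw [min_eq_right h, max_eq_right (by linarith), max_eq_right (by linarith),
        max_eq_left (by linarith)]
      ring
    · rw [min_eq_right h, max_eq_right (by linarith), max_eq_left (by linarith),
        max_eq_left (by linarith)]
      linarith
  rw [clippedAffine_eq_max_min (by linarith), h3]
  ring

theorem dualField_le {lam : ℝ} (hlam : 0 ≤ lam) (L a x : ℝ) :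
    dualField L lam a x ≤ lam / 2 * (L - a) ^ 2 := by
  unfold dualField
  gcongr
  linarith [sq_nonneg (max (-a - x) 0), sq_nonneg (max (x - a) 0)]

theorem dualField_pos {L lam a x : ℝ} (hlam : 0 < lam) (ha : 0 ≤ a) (haL : a < L)
    (hx : x ∈ Ioo (-L) L) : 0 < dualField L lam a x := by
  unfold dualField
  refine mul_pos (by positivity) ?_
  have h1 : max (-a - x) 0 < L - a := max_lt (by linarith [hx.1]) (by linarith)
  have h2 : max (x - a) 0 < L - a := max_lt (by linarith [hx.2]) (by linarith)
  have h3 := pow_lt_pow_left₀ h1 (le_max_right _ _) two_ne_zero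
  have h4 := pow_lt_pow_left₀ h2 (le_max_right _ _) two_ne_zero
  -- As `0 ≤ a`, at most one of the two squares is nonzero at `x`.
  rcases le_total x 0 with h | h
  · rw [max_eq_right (by linarith : x - a ≤ 0)]
    linarith
  · rw [max_eq_right (by linarith : -a - x ≤ 0)]
    linarith

theorem dualField_nonpos {L lam a x : ℝ} (hlam : 0 ≤ lam) (haL : a ≤ L)
    (hx : x ∉ Ioo (-L) L) : dualField L lam a x ≤ 0 := by
  unfold dualField
  refine mul_nonpos_of_nonneg_of_nonpos (by positivity) ?_
  rcases le_or_gt x (-L) with h | h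
  · have : (L - a) ^ 2 ≤ max (-a - x) 0 ^ 2 :=
      pow_le_pow_left₀ (by linarith) (le_max_of_le_left (by linarith)) 2
    linarith [sq_nonneg (max (x - a) 0)]
  · have hxL : L ≤ x := not_lt.1 fun h' => hx ⟨h, h'⟩
    have : (L - a) ^ 2 ≤ max (x - a) 0 ^ 2 :=
      pow_le_pow_left₀ (by linarith) (le_max_of_le_left (by linarith)) 2
    linarith [sq_nonneg (max (-a - x) 0)]

/-- Equality in the certificate: `z' = 0` on `[-a, a]`, while on each outer piece `u = ∓lam a` is
constant and `z` changes by `±α₀`. So `-∫ u z' = 2 lam a α₀ = α₀ |Du|(Ω)`. -/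
theorem solvesScalarTV_clippedAffine {L lam a : ℝ} (hlam : 0 < lam) (ha : 0 ≤ a) (haL : a < L) :
    SolvesScalarTV (Ioo (-L) L) (lam / 2 * (L - a) ^ 2) (fun x => lam * x)
      (clippedAffine lam (-a) a) := by
  have hc : Continuous (clippedAffine lam (-a) a) := continuous_clippedAffine (by linarith)
  refine isMinimiser_of_dual (by fun_prop) hc
    (hasBVDeriv_clippedAffine hlam.le (by linarith) (by linarith) haL)
    (hasDerivAt_dualField L ha) (fun x hx => dualField_pos hlam ha haL hx)
    (fun x hx => dualField_nonpos hlam.le haL.le hx) (fun x => dualField_le hlam.le L a x)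
    (by positivity) ?_
  rw [totalVariation_clippedAffine hlam.le (by linarith) (by linarith) haL,
    integral_clippedAffine_mul (by linarith) (by linarith) haL.le (by fun_prop)]
  have hz (s t : ℝ) : ∫ x in s..t, (clippedAffine lam (-a) a x - lam * x) =
      dualField L lam a t - dualField L lam a s :=
    intervalIntegral.integral_eq_sub_of_hasDerivAt (fun x _ => hasDerivAt_dualField L ha x)
      ((hc.sub (by fun_prop)).intervalIntegrable _ _)
  have hmid : ∫ x in (-a)..a, x * (clippedAffine lam (-a) a x - lam * x) = 0 := by
    rw [← intervalIntegral.integral_zero (μ := volume) (a := -a) (b := a)]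
    refine intervalIntegral.integral_congr fun x hx => ?_
    rw [uIcc_of_le (by linarith)] at hx
    simp only [clippedAffine_eq_max_min (by linarith : -a ≤ a)]
    rw [min_eq_left hx.2, max_eq_right hx.1, sub_self, mul_zero]
  have hin (x : ℝ) (hx : |x| = a) : dualField L lam a x = lam / 2 * (L - a) ^ 2 := by
    unfold dualField
    rw [max_eq_right (by linarith [neg_le_abs x]), max_eq_right (by linarith [le_abs_self x])]
    ring
  have hout (x : ℝ) (hx : |x| = L) : dualField L lam a x = 0 := by
    unfold dualField
    rcases (abs_eq (by linarith)).1 hx with rfl | rfl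
    · rw [max_eq_right (by linarith), max_eq_left (by linarith)]
      ring
    · rw [max_eq_left (by linarith), max_eq_right (by linarith)]
      ring
  rw [hz, hz, hmid, hin a (abs_of_nonneg ha), hin (-a) (by rw [abs_neg, abs_of_nonneg ha]),
    hout L (abs_of_pos (by linarith)), hout (-L) (by rw [abs_neg, abs_of_pos (by linarith)])]
  linarith

/-! ### The mean of the residual and the conclusion -/

theorem integral_sub_clippedAffine {L lam x₁ x₂ : ℝ} (hx₁ : -L ≤ x₁) (hx₁₂ : x₁ ≤ x₂)
    (hx₂ : x₂ ≤ L) : ∫ x in Ioo (-L) L, (lam * x - clippedAffine lam x₁ x₂ x) =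
      -(lam * (x₁ + x₂) * (L - (x₂ - x₁) / 2)) := by
  have hc : Continuous (clippedAffine lam x₁ x₂) := continuous_clippedAffine hx₁₂
  have hcont {g : ℝ → ℝ} (hg : Continuous g) : IntegrableOn g (Ioo (-L) L) :=
    (hg.continuousOn.integrableOn_compact isCompact_Icc).mono_set Ioo_subset_Icc_self
  have h := integral_clippedAffine_mul (lam := lam) hx₁ hx₁₂ hx₂
    (continuous_const (y := (1 : ℝ)))
  simp only [mul_one] at h
  rw [integral_sub (hcont (by fun_prop)) (hcont hc), h, setIntegral_Ioo_eq (by linarith),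
    intervalIntegral.integral_const_mul lam fun x => x]
  simp only [integral_id, intervalIntegral.integral_const,
    smul_eq_mul, mul_one]
  ring

end WeightedTV

theorem proposition6p4 (L lam : ℝ) (hL : 0 < L) (hlam : 0 < lam)
    (x₁ x₂ : ℝ) (hx₁ : -L < x₁) (hx₁₂ : x₁ ≤ x₂) (hx₂ : x₂ < L)
    (u : ℝ → ℝ)
    (hu : ∀ᵐ x ∂(volume.restrict (Ioo (-L) L)), u x = WeightedTV.clippedAffine lam x₁ x₂ x) :
    (∀ α : ℝ → ℝ, WeightedTV.IsTVWeight L α →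
      WeightedTV.SolvesWeightedTV (Ioo (-L) L) α (fun x => lam * x) u →
      x₁ = -x₂ ∧ ∀ᵐ x ∂(volume.restrict (Ioo (-L) L)), u (-x) = -u x) ∧
    ((∃ α w : ℝ → ℝ, WeightedTV.IsTVWeight L α ∧ WeightedTV.IsFidelityWeight L w ∧
        WeightedTV.SolvesWeightedTV (Ioo (-L) L) α (fun x => lam * x) u ∧
        WeightedTV.SolvesWeightedFidelity (Ioo (-L) L) w (fun x => lam * x) u) ↔
      x₁ = -x₂) ∧
    (x₁ = -x₂ ↔
      ∃ α₀ : ℝ, 0 < α₀ ∧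
        WeightedTV.SolvesScalarTV (Ioo (-L) L) α₀ (fun x => lam * x) u) := by
  have hsym : ∀ α : ℝ → ℝ, WeightedTV.IsTVWeight L α →
      WeightedTV.SolvesWeightedTV (Ioo (-L) L) α (fun x => lam * x) u → x₁ = -x₂ := by
    intro α hα h
    have h0 := (WeightedTV.IsMinimiser.congr_ae hu h).integral_sub_eq_zero (by linarith) hα.1
      (by fun_prop) (WeightedTV.continuous_clippedAffine hx₁₂)
    rw [WeightedTV.integral_sub_clippedAffine hx₁.le hx₁₂ hx₂.le, neg_eq_zero] at h0
    -- The factor `L - (x₂ - x₁) / 2` cannot vanish, since `x₂ - x₁ < 2L`.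
    rcases mul_eq_zero.1 h0 with h1 | h1
    · rcases mul_eq_zero.1 h1 with h2 | h2 <;> linarith
    · linarith
  have hsol : x₁ = -x₂ → ∃ α₀ : ℝ, 0 < α₀ ∧
      WeightedTV.SolvesScalarTV (Ioo (-L) L) α₀ (fun x => lam * x) u := by
    rintro rfl
    exact ⟨lam / 2 * (L - x₂) ^ 2, mul_pos (by positivity) (pow_pos (by linarith) 2),
      (WeightedTV.solvesScalarTV_clippedAffine hlam (by linarith) hx₂).congr_ae
        (Filter.EventuallyEq.symm hu)⟩
  have hconst {c : ℝ} (hc : 0 < c) : WeightedTV.IsTVWeight L fun _ => c :=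
    ⟨continuousOn_const, fun _ _ => hc⟩
  refine ⟨fun α hα h => ⟨hsym α hα h, ?_⟩, ⟨fun ⟨α, w, hα, _, h, _⟩ => hsym α hα h, fun h => ?_⟩,
    hsol, fun ⟨α₀, h0, h⟩ => hsym _ (hconst h0) h⟩
  · obtain rfl := hsym α hα h
    -- Reflection preserves the measure, so `hu` also holds at `-x` for a.e. `x`.
    have hmp : MeasurePreserving (fun x : ℝ => -x) (volume.restrict (Ioo (-L) L))
        (volume.restrict (Ioo (-L) L)) := by
      have := (Measure.measurePreserving_neg (volume : Measure ℝ)).restrict_preimage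
        (measurableSet_Ioo (a := -L) (b := L))
      simpa using this
    filter_upwards [hu, hmp.quasiMeasurePreserving.ae hu] with x hx hx'
    rw [hx, hx', WeightedTV.clippedAffine_neg_neg (by linarith)]
  · obtain ⟨α₀, h0, hs⟩ := hsol h
    refine ⟨fun _ => α₀, fun _ => α₀⁻¹, hconst h0,
      ⟨memLp_top_const _, Filter.Eventually.of_forall fun _ => (inv_pos.2 h0).le⟩, hs, ?_⟩
    have h1 := WeightedTV.IsMinimiser.const_mul (inv_pos.2 h0).le hs
    simp only [mul_one, inv_mul_cancel₀ h0.ne'] at h1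
    exact h1
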